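/- Let $\mathbb{D}$ be the open unit disc, $\mathbb{T}$ the unit circle and $m$ normalized arc length on $\mathbb{T}$; boundary values are radial limits $f(\zeta)=\lim_{r\to1^-}f(r\zeta)$. An inner function is a bounded analytic function $u$ on $\mathbb{D}$ with $|u(\zeta)|=1$ for $m$-a.e. $\zeta\in\mathbb{T}$ (unimodular constants are allowed). An outer function is a function on $\mathbb{D}$ of the form $$F(z)=e^{i\gamma}\exp\left(\int_{\mathbb{T}}\frac{\zeta+z}{\zeta-z}\,\phi(\zeta)\,dm(\zeta)\right)$$ with $\gamma\in\mathbb{R}$ and $\phi\in L^1(\mathbb{T},m)$ real-valued. The Smirnov class $N^+$ consists of the quotients $g/h$ of bounded analytic functions on $\mathbb{D}$ with $h$ outer. A real Smirnov function is an $f\in N^+$ whose boundary function is real-valued $m$-a.e. on $\mathbb{T}$. **Theorem (Helson).** If $f$ is a real Smirnov function, then there exist inner functions $\psi_1,\psi_2$ such that $\psi_1-\psi_2$ is outer and $$f=i\,\frac{\psi_1+\psi_2}{\psi_1-\psi_2}\quad\text{on }\mathbb{D}.$$ -/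

import Mathlib

open Filter Topology

namespace HardyDisc

/-- `f` is bounded and analytic on the open unit disc, i.e. its restriction to the disc lies in
`H^∞`. Functions on the disc are represented by functions `ℂ → ℂ`, only the values on
`Metric.ball 0 1` being relevant. -/
def IsBoundedAnalytic (f : ℂ → ℂ) : Prop :=
  AnalyticOnNhd ℂ f (Metric.ball 0 1) ∧ ∃ C : ℝ, ∀ z ∈ Metric.ball (0 : ℂ) 1, ‖f z‖ ≤ C

/-- The radial limit of `f` at the point `ζ` of the unit circle exists and equals `w`. -/
def HasRadialLimit (f : ℂ → ℂ) (ζ w : ℂ) : Prop :=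
  Tendsto (fun r : ℝ => f ((r : ℂ) * ζ)) (𝓝[<] (1 : ℝ)) (𝓝 w)

/-- Inner functions: bounded analytic functions on the disc whose boundary function is unimodular
almost everywhere. The points of the unit circle are written `circleMap 0 1 θ = exp (i θ)`; as this
is periodic in `θ`, "for almost every real `θ`" means "for almost every point of the circle". -/
def IsInner (u : ℂ → ℂ) : Prop :=
  IsBoundedAnalytic u ∧
    ∀ᵐ θ : ℝ, ∃ w : ℂ, ‖w‖ = 1 ∧ HasRadialLimit u (circleMap 0 1 θ) w

/-- Outer functions: `F z = e^{iγ} exp (∫ (ζ + z) / (ζ - z) φ(ζ) dm(ζ))` on the disc, where `γ` is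
real, `φ` is real-valued and integrable on the unit circle, and `m` is normalized arc length. -/
def IsOuter (F : ℂ → ℂ) : Prop :=
  ∃ (γ : ℝ) (φ : ℂ → ℝ), CircleIntegrable φ 0 1 ∧ ∀ z ∈ Metric.ball (0 : ℂ) 1,
    F z = Complex.exp (γ * Complex.I) *
      Complex.exp (Real.circleAverage (fun ζ : ℂ => (ζ + z) / (ζ - z) * (φ ζ : ℂ)) 0 1)

/-- The Smirnov class `N⁺`: quotients of bounded analytic functions on the disc with outer
denominator (which has no zeros in the disc). -/
def IsSmirnov (f : ℂ → ℂ) : Prop :=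
  ∃ g h : ℂ → ℂ, IsBoundedAnalytic g ∧ IsBoundedAnalytic h ∧ IsOuter h ∧
    ∀ z ∈ Metric.ball (0 : ℂ) 1, f z = g z / h z

/-- Real Smirnov functions: members of `N⁺` whose boundary function is real-valued almost everywhere
on the unit circle. -/
def IsRealSmirnov (f : ℂ → ℂ) : Prop :=
  IsSmirnov f ∧ ∀ᵐ θ : ℝ, ∃ x : ℝ, HasRadialLimit f (circleMap 0 1 θ) (x : ℂ)

end HardyDisc

/-! Write `f = g / h` with `h` outer of boundary log-modulus `φ`, and let `x` be the real boundary
function of `f`. Since `|x + i| = |x - i|`, the functions `g + ih` and `g - ih` share the boundary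
modulus `exp Φ`, where `Φ = φ + ½ log (1 + x²)`. This `Φ` is integrable: it is at least `φ`, and
bounded above because `g + ih` is bounded. Dividing both functions by the outer function `O` of
log-modulus `Φ` gives inner functions whose difference `2ih / O` is outer and whose sum is `2g / O`;
the formula for `f` is then algebra.

The analysis lies in `isInner_div_outerOf`. It needs boundary moduli of outer functions
(`ae_tendsto_poissonIntegral`), radial limits of bounded analytic functions
(`IsBoundedAnalytic.ae_hasRadialLimit`) and the domination `norm_le_exp_poissonIntegral`, without
which the quotients might be unbounded. -/

namespace HardyDisc
open MeasureTheory Set Real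

/-! ### The Poisson kernel in the angular variable. -/

/-- The Poisson integral over the unit circle of a real-valued function. -/
noncomputable def poissonIntegral (φ : ℂ → ℝ) (z : ℂ) : ℝ :=
  circleAverage (fun ζ => poissonKernel 0 z ζ * φ ζ) 0 1

/-- The Poisson kernel at radius `r` as a function of the angle. -/
noncomputable def anglePoisson (r s : ℝ) : ℝ := (1 - r ^ 2) / (1 + r ^ 2 - 2 * r * cos s)

lemma anglePoisson_denom_pos {r : ℝ} (h0 : 0 < r) (h1 : r < 1) (s : ℝ) :
    0 < 1 + r ^ 2 - 2 * r * cos s := by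
  nlinarith [cos_le_one s, sq_nonneg (1 - r), mul_pos h0 h0, sq_pos_of_pos (sub_pos.2 h1)]

lemma poissonKernel_circleMap {r : ℝ} (θ s : ℝ) :
    poissonKernel 0 ((r : ℂ) * circleMap 0 1 θ) (circleMap 0 1 (s + θ)) = anglePoisson r s := by
  have h1 : ‖circleMap 0 1 (s + θ) - (r : ℂ) * circleMap 0 1 θ‖ ^ 2
      = 1 + r ^ 2 - 2 * r * cos s := by
    have : circleMap 0 1 (s + θ) - (r : ℂ) * circleMap 0 1 θ
        = (Complex.exp (s * Complex.I) - r) * Complex.exp (θ * Complex.I) := by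
      simp [circleMap, add_mul, Complex.exp_add]; ring
    rw [this, norm_mul, Complex.norm_exp_ofReal_mul_I, mul_one, ← Complex.normSq_eq_norm_sq,
      Complex.normSq_apply]
    simp only [Complex.sub_re, Complex.sub_im, Complex.exp_ofReal_mul_I_re,
      Complex.exp_ofReal_mul_I_im, Complex.ofReal_re, Complex.ofReal_im]
    nlinarith [sin_sq_add_cos_sq s]
  rw [poissonKernel_def, sub_zero, sub_zero, h1, anglePoisson]
  simp

/-- The derivative of `anglePoisson r`. -/
noncomputable def anglePoissonDeriv (r s : ℝ) : ℝ :=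
  -((1 - r ^ 2) * (2 * r * sin s)) / (1 + r ^ 2 - 2 * r * cos s) ^ 2

lemma hasDerivAt_anglePoisson {r : ℝ} (h0 : 0 < r) (h1 : r < 1) (s : ℝ) :
    HasDerivAt (anglePoisson r) (anglePoissonDeriv r s) s := by
  have h := (((hasDerivAt_cos s).const_mul (2 * r)).const_sub (1 + r ^ 2))
  have h2 := (hasDerivAt_const s (1 - r ^ 2)).div h (anglePoisson_denom_pos h0 h1 s).ne'
  refine h2.congr_deriv ?_
  simp only [anglePoissonDeriv]
  ring

lemma continuous_anglePoissonDeriv {r : ℝ} (h0 : 0 < r) (h1 : r < 1) :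
    Continuous (anglePoissonDeriv r) := by
  unfold anglePoissonDeriv
  exact Continuous.div (by fun_prop) (by fun_prop)
    fun s => pow_ne_zero 2 (anglePoisson_denom_pos h0 h1 s).ne'

lemma contDiff_anglePoisson {r : ℝ} (h0 : 0 < r) (h1 : r < 1) : ContDiff ℝ 1 (anglePoisson r) := by
  unfold anglePoisson
  exact ContDiff.div (by fun_prop) (by fun_prop) fun s => (anglePoisson_denom_pos h0 h1 s).ne'

/-- The denominator is `(1 - r)² + 2r(1 - cos s)`, hence at least `1 - cos δ` once `2r ≥ 1`. -/
lemma abs_anglePoissonDeriv_le {r δ s : ℝ} (h0 : 1 / 2 ≤ r) (h1 : r < 1) (hδ : 0 < δ)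
    (hs : δ ≤ |s|) (hs' : |s| ≤ π) :
    |anglePoissonDeriv r s| ≤ 2 * (1 - r ^ 2) / (1 - cos δ) ^ 2 := by
  have hc : cos s ≤ cos δ := by
    rw [← cos_abs s]; exact cos_le_cos_of_nonneg_of_le_pi hδ.le hs' hs
  have hδ' : 0 < 1 - cos δ := by
    have := cos_lt_cos_of_nonneg_of_le_pi le_rfl (hs.trans hs') hδ
    rw [cos_zero] at this; linarith
  have hr : 0 ≤ 1 - r ^ 2 := by nlinarith
  have hd : 1 - cos δ ≤ 1 + r ^ 2 - 2 * r * cos s := by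
    nlinarith [sq_nonneg (1 - r), cos_le_one s]
  have hsin : |2 * r * sin s| ≤ 2 := by
    rw [abs_mul, abs_of_nonneg (by linarith)]
    nlinarith [abs_sin_le_one s, abs_nonneg (sin s)]
  rw [anglePoissonDeriv, abs_div, abs_neg, abs_mul, abs_of_nonneg hr, abs_pow, sq_abs, mul_comm 2 (1 - r ^ 2)]
  exact div_le_div₀ (by positivity) (mul_le_mul_of_nonneg_left hsin hr) (by positivity)
    (pow_le_pow_left₀ hδ'.le hd 2)

/-- The kernel decreases away from `s = 0`, so its derivative has sign opposite to `s`. -/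
lemma neg_mul_anglePoissonDeriv_nonneg {r s : ℝ} (h0 : 0 < r) (h1 : r < 1) (hs : |s| ≤ π) :
    |anglePoissonDeriv r s| * |s| = -(s * anglePoissonDeriv r s) := by
  have h : 0 ≤ s * sin s := by
    rcases le_total 0 s with h | h
    · exact mul_nonneg h (sin_nonneg_of_nonneg_of_le_pi h ((le_abs_self s).trans hs))
    · exact mul_nonneg_of_nonpos_of_nonpos h
        (sin_nonpos_of_nonpos_of_neg_pi_le h (by linarith [neg_abs_le s]))
  rw [← abs_mul, mul_comm, abs_of_nonpos]
  have : s * anglePoissonDeriv r s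
      = -(((1 - r ^ 2) * (2 * r * (s * sin s))) / (1 + r ^ 2 - 2 * r * cos s) ^ 2) := by
    unfold anglePoissonDeriv; ring
  rw [this, neg_nonpos]
  have : 0 ≤ 1 - r ^ 2 := by nlinarith
  positivity

lemma poissonIntegral_eq_integral (φ : ℂ → ℝ) (r θ : ℝ) :
    poissonIntegral φ ((r : ℂ) * circleMap 0 1 θ)
      = (2 * π)⁻¹ * ∫ s in -π..π, anglePoisson r s * φ (circleMap 0 1 (s + θ)) := by
  rw [poissonIntegral, circleAverage_eq_integral_add θ, smul_eq_mul]
  congr 1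
  simp only [poissonKernel_circleMap]
  have hp : Function.Periodic (fun s => anglePoisson r s * φ (circleMap 0 1 (s + θ))) (2 * π) := by
    intro s
    have : circleMap 0 1 (s + 2 * π + θ) = circleMap 0 1 (s + θ) := by
      rw [show s + 2 * π + θ = s + θ + 2 * π by ring, periodic_circleMap]
    simp [anglePoisson, this]
  have := hp.intervalIntegral_add_eq 0 (-π)
  rw [zero_add, show -π + 2 * π = π by ring] at this
  exact this

lemma poissonIntegral_const {z : ℂ} (hz : z ∈ Metric.ball (0 : ℂ) 1) (c : ℝ) :
    poissonIntegral (fun _ => c) z = c := by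
  have h := InnerProductSpace.HarmonicOnNhd.circleAverage_poissonKernel_smul
    (f := fun _ => c) (c := 0) (R := 1) (w := z) (fun x _ => ?_) hz
  · exact h
  · exact InnerProductSpace.harmonicAt_const c

lemma integral_anglePoisson {r : ℝ} (h0 : 0 < r) (h1 : r < 1) :
    ∫ s in -π..π, anglePoisson r s = 2 * π := by
  have h := poissonIntegral_eq_integral (fun _ => 1) r 0
  rw [poissonIntegral_const (by simp [abs_of_pos h0, h1])] at h
  simp only [mul_one] at h
  field_simp at h
  linarith

/-- By parts the integral is the total mass `2π` minus a nonnegative boundary term. The bound is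
uniform in `r`, which is what the limit `r → 1` needs. -/
lemma integral_neg_mul_anglePoissonDeriv_le {r : ℝ} (h0 : 0 < r) (h1 : r < 1) :
    ∫ s in -π..π, -(s * anglePoissonDeriv r s) ≤ 2 * π := by
  have h := intervalIntegral.integral_mul_deriv_eq_deriv_mul (a := -π) (b := π) (u := fun s => s)
    (u' := fun _ => 1) (v := anglePoisson r) (v' := anglePoissonDeriv r)
    (fun s _ => hasDerivAt_id s) (fun s _ => hasDerivAt_anglePoisson h0 h1 s)
    (by simp) ((continuous_anglePoissonDeriv h0 h1).intervalIntegrable _ _)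
  rw [intervalIntegral.integral_neg, h]
  simp only [one_mul, integral_anglePoisson h0 h1]
  have hp : ∀ s, 0 ≤ anglePoisson r s := fun s =>
    div_nonneg (by nlinarith) (anglePoisson_denom_pos h0 h1 s).le
  nlinarith [hp π, hp (-π), pi_pos]

/-! ### Fatou's theorem for Poisson integrals. -/

/-- Only the primitive `K` of `k` is controlled at `0`, so integration by parts moves the derivative
onto the kernel. Near `0`, `K s = o(s)` meets the uniform bound on `∫ |s| |P'|`; away from `0`, `P'`
tends to zero uniformly. -/
lemma tendsto_integral_anglePoisson_mul {k : ℝ → ℝ}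
    (hk : ∀ a b, IntervalIntegrable k volume a b)
    (hd : HasDerivAt (fun s => ∫ t in (0 : ℝ)..s, k t) 0 0) :
    Tendsto (fun r => ∫ s in -π..π, anglePoisson r s * k s) (𝓝[<] 1) (𝓝 0) := by
  set K : ℝ → ℝ := fun s => ∫ t in (0 : ℝ)..s, k t with hK
  have hπ := pi_pos
  have hKc : Continuous K := intervalIntegral.continuous_primitive hk 0
  obtain ⟨M, hM⟩ : ∃ M, ∀ s ∈ Icc (-π) π, ‖K s‖ ≤ M :=
    isCompact_Icc.exists_bound_of_continuousOn hKc.continuousOn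
  have hM0 : 0 ≤ M := (norm_nonneg _).trans (hM 0 ⟨by linarith, hπ.le⟩)
  have hKac : AbsolutelyContinuousOnInterval K (-π) π :=
    (hk (-π) π).absolutelyContinuousOnInterval_intervalIntegral
      (by rw [uIcc_of_le (by linarith)]; exact ⟨by linarith, hπ.le⟩)
  have hderiv : ∀ᵐ s, s ∈ uIoc (-π) π → deriv K s = k s := by
    filter_upwards [(hk (-π) π).ae_hasDerivAt_integral] with s hs hs'
    exact (hs (uIoc_subset_uIcc hs') 0
      (by rw [uIcc_of_le (by linarith)]; exact ⟨by linarith, hπ.le⟩)).deriv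
  have hparts : ∀ r, 0 < r → r < 1 → ∫ s in -π..π, anglePoisson r s * k s
      = anglePoisson r π * (K π - K (-π)) - ∫ s in -π..π, anglePoissonDeriv r s * K s := by
    intro r h0 h1
    have hac : AbsolutelyContinuousOnInterval (anglePoisson r) (-π) π :=
      (contDiff_anglePoisson h0 h1).contDiffOn.absolutelyContinuousOnInterval
    have := hac.integral_mul_deriv_eq_deriv_mul hKac
    rw [show ∫ s in -π..π, anglePoisson r s * k s = ∫ s in -π..π, anglePoisson r s * deriv K s from
      intervalIntegral.integral_congr_ae (by filter_upwards [hderiv] with s hs h; rw [hs h]), this]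
    simp only [(hasDerivAt_anglePoisson h0 h1 _).deriv]
    simp only [anglePoisson, cos_neg]; ring
  rw [Metric.tendsto_nhds]
  intro ε hε
  -- Against the bound `2π`, the slope `ε / (4π)` contributes `ε / 2`; `hlim` supplies the other
  -- half.
  obtain ⟨δ, hδ, hδK⟩ : ∃ δ > 0, ∀ s, |s| < δ → |K s| ≤ ε / (4 * π) * |s| := by
    have := hd.isLittleO.def (c := ε / (4 * π)) (by positivity)
    obtain ⟨δ, hδ, h⟩ := Metric.eventually_nhds_iff.1 this
    refine ⟨δ, hδ, fun s hs => ?_⟩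
    simpa [hK] using h (y := s) (by simpa using hs)
  have hlim : Tendsto (fun r : ℝ => anglePoisson r π * |K π - K (-π)|
      + 2 * π * (M * (2 * (1 - r ^ 2) / (1 - cos δ) ^ 2))) (𝓝[<] 1) (𝓝 0) := by
    have : ContinuousAt (fun r : ℝ => anglePoisson r π * |K π - K (-π)|
      + 2 * π * (M * (2 * (1 - r ^ 2) / (1 - cos δ) ^ 2))) 1 := by
      unfold anglePoisson
      have : (1 + 1 ^ 2 - 2 * 1 * cos π : ℝ) ≠ 0 := by simp; norm_num
      fun_prop (disch := assumption)
    have := this.tendsto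
    simp only [anglePoisson, one_pow, sub_self, zero_div, zero_mul, mul_zero, add_zero] at this
    exact this.mono_left nhdsWithin_le_nhds
  filter_upwards [hlim.eventually (gt_mem_nhds (half_pos hε)), self_mem_nhdsWithin,
    Ioo_mem_nhdsLT (show (1 / 2 : ℝ) < 1 by norm_num)] with r hr h1 h0
  have h0' : 0 < r := by linarith [h0.1]
  have h1' : r < 1 := h1
  set η := M * (2 * (1 - r ^ 2) / (1 - cos δ) ^ 2)
  have hη : 0 ≤ η := by
    have : 0 ≤ 1 - r ^ 2 := by nlinarith
    positivity
  have hpt : ∀ s ∈ Icc (-π) π,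
      |anglePoissonDeriv r s * K s| ≤ ε / (4 * π) * -(s * anglePoissonDeriv r s) + η := by
    intro s hs
    have hs' : |s| ≤ π := abs_le.2 hs
    rw [abs_mul, ← neg_mul_anglePoissonDeriv_nonneg h0' h1' hs']
    rcases lt_or_ge |s| δ with h | h
    · calc _ ≤ |anglePoissonDeriv r s| * (ε / (4 * π) * |s|) := by gcongr; exact hδK s h
        _ ≤ _ := by linarith
    · calc _ ≤ (2 * (1 - r ^ 2) / (1 - cos δ) ^ 2) * M := by
            refine mul_le_mul (abs_anglePoissonDeriv_le h0.1.le h1' hδ h hs') (hM s hs)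
              (abs_nonneg _) ?_
            have : 0 ≤ 1 - r ^ 2 := by nlinarith
            positivity
        _ ≤ _ := by
            have : 0 ≤ ε / (4 * π) * (|anglePoissonDeriv r s| * |s|) := by positivity
            linarith
  have hcd := continuous_anglePoissonDeriv h0' h1'
  have hint : |∫ s in -π..π, anglePoissonDeriv r s * K s| ≤ ε / 2 + 2 * π * η := by
    calc _ ≤ ∫ s in -π..π, |anglePoissonDeriv r s * K s| :=
          intervalIntegral.abs_integral_le_integral_abs (by linarith)
      _ ≤ ∫ s in -π..π, (ε / (4 * π) * -(s * anglePoissonDeriv r s) + η) :=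
          intervalIntegral.integral_mono_on (by linarith)
            (Continuous.intervalIntegrable (by fun_prop) _ _)
            (Continuous.intervalIntegrable (by fun_prop) _ _) hpt
      _ = ε / (4 * π) * (∫ s in -π..π, -(s * anglePoissonDeriv r s)) + 2 * π * η := by
          rw [intervalIntegral.integral_add (Continuous.intervalIntegrable (by fun_prop) _ _)
            (by simp), intervalIntegral.integral_const_mul, intervalIntegral.integral_const,
            smul_eq_mul]
          ring
      _ ≤ ε / (4 * π) * (2 * π) + 2 * π * η := by
          gcongr; exact integral_neg_mul_anglePoissonDeriv_le h0' h1'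
      _ = _ := by field_simp; ring
  rw [Real.dist_eq, sub_zero, hparts r h0' h1']
  have hp : 0 ≤ anglePoisson r π :=
    div_nonneg (by nlinarith) (anglePoisson_denom_pos h0' h1' π).le
  calc _ ≤ |anglePoisson r π * (K π - K (-π))| + |∫ s in -π..π, anglePoissonDeriv r s * K s| :=
        abs_sub _ _
    _ < ε := by rw [abs_mul, abs_of_nonneg hp]; linarith

lemma CircleIntegrable.intervalIntegrable_circleMap {φ : ℂ → ℝ} (hφ : CircleIntegrable φ 0 1)
    (a b : ℝ) : IntervalIntegrable (fun θ => φ (circleMap 0 1 θ)) volume a b := by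
  have hp : Function.Periodic (fun θ => φ (circleMap 0 1 θ)) (2 * π) := fun θ => by
    simp only [periodic_circleMap 0 1 θ]
  exact hp.intervalIntegrable₀ (by positivity) hφ a b

/-- **Fatou's theorem**: the Poisson integral of an integrable function has that function as its
radial boundary function almost everywhere. -/
theorem ae_tendsto_poissonIntegral {φ : ℂ → ℝ} (hφ : CircleIntegrable φ 0 1) :
    ∀ᵐ θ : ℝ, Tendsto (fun r : ℝ => poissonIntegral φ ((r : ℂ) * circleMap 0 1 θ)) (𝓝[<] 1)
      (𝓝 (φ (circleMap 0 1 θ))) := by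
  have hi := CircleIntegrable.intervalIntegrable_circleMap hφ
  have hloc : LocallyIntegrable (fun θ => φ (circleMap 0 1 θ)) volume :=
    fun x => ⟨Ioc (x - 1) (x + 1), Ioc_mem_nhds (by linarith) (by linarith), (hi _ _).1⟩
  filter_upwards [LocallyIntegrable.ae_hasDerivAt_integral hloc] with θ hθ
  set c := φ (circleMap 0 1 θ)
  have hi' : ∀ a b, IntervalIntegrable (fun s => φ (circleMap 0 1 (s + θ))) volume a b := fun a b =>
    (IntervalIntegrable.comp_add_right_iff enorm_ne_top).2 (hi (a + θ) (b + θ))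
  -- Rotating to `θ` and subtracting the boundary value makes the primitive have derivative zero at
  -- `0`.
  have h := tendsto_integral_anglePoisson_mul (k := fun s => φ (circleMap 0 1 (s + θ)) - c)
    (fun a b => (hi' a b).sub (by simp)) ?_
  · have h2 := (h.const_mul (2 * π)⁻¹).add_const c
    rw [mul_zero, zero_add] at h2
    refine h2.congr' ?_
    filter_upwards [self_mem_nhdsWithin, Ioo_mem_nhdsLT (zero_lt_one' ℝ)] with r h1 h0
    have hc : Continuous (anglePoisson r) := (contDiff_anglePoisson h0.1 h1).continuous
    rw [poissonIntegral_eq_integral]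
    simp only [mul_sub]
    rw [intervalIntegral.integral_sub ((hi' _ _).continuousOn_mul hc.continuousOn)
      (Continuous.intervalIntegrable (by fun_prop) _ _), intervalIntegral.integral_mul_const,
      integral_anglePoisson h0.1 h1]
    field_simp
    ring
  · have h1 : (fun s => ∫ t in (0 : ℝ)..s, (φ (circleMap 0 1 (t + θ)) - c))
        = fun s => (∫ t in θ..s + θ, φ (circleMap 0 1 t)) - s * c := by
      ext s
      rw [intervalIntegral.integral_sub (hi' _ _) (by simp),
        intervalIntegral.integral_comp_add_right (fun t => φ (circleMap 0 1 t)) θ]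
      simp
    rw [h1]
    have h2 : HasDerivAt (fun s => ∫ t in θ..s + θ, φ (circleMap 0 1 t)) c 0 := by
      have h3 := hθ θ
      rw [← zero_add θ] at h3
      simpa using h3.comp_add_const 0 θ
    exact (h2.fun_sub ((hasDerivAt_id (0 : ℝ)).mul_const c)).congr_deriv (by simp)

/-! ### Dilations and the maximum principle for radial boundary values. -/

lemma continuousOn_poissonKernel_sphere {z : ℂ} (hz : z ∈ Metric.ball (0 : ℂ) 1) :
    ContinuousOn (poissonKernel 0 z) (Metric.sphere 0 1) := by
  rw [poissonKernel_eq_re_herglotzRieszKernel]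
  have := continuousOn_herglotzRieszKernel_sphere hz
  rw [abs_one] at this
  exact Complex.continuous_re.comp_continuousOn this

lemma poissonKernel_nonneg {z ζ : ℂ} (hz : z ∈ Metric.ball (0 : ℂ) 1)
    (hζ : ζ ∈ Metric.sphere (0 : ℂ) 1) : 0 ≤ poissonKernel 0 z ζ := by
  simp only [mem_ball_zero_iff, mem_sphere_zero_iff_norm] at hz hζ
  rw [poissonKernel_def, sub_zero, sub_zero, hζ]
  have : 0 ≤ 1 ^ 2 - ‖z‖ ^ 2 := by nlinarith [norm_nonneg z]
  positivity

lemma circleMap_mem_unit_sphere (θ : ℝ) : circleMap 0 1 θ ∈ Metric.sphere (0 : ℂ) 1 := by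
  simp

lemma continuous_poissonKernel_circleMap {z : ℂ} (hz : z ∈ Metric.ball (0 : ℂ) 1) :
    Continuous fun θ => poissonKernel 0 z (circleMap 0 1 θ) :=
  (continuousOn_poissonKernel_sphere hz).comp_continuous (continuous_circleMap 0 1)
    circleMap_mem_unit_sphere

lemma CircleIntegrable.poissonKernel_mul {φ : ℂ → ℝ} (hφ : CircleIntegrable φ 0 1) {z : ℂ}
    (hz : z ∈ Metric.ball (0 : ℂ) 1) :
    CircleIntegrable (fun ζ => poissonKernel 0 z ζ * φ ζ) 0 1 :=
  IntervalIntegrable.continuousOn_mul hφ (continuous_poissonKernel_circleMap hz).continuousOn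

lemma ofReal_mul_circleMap_mem_ball {r : ℝ} (hr : r ∈ Ioo (0 : ℝ) 1) (θ : ℝ) :
    (r : ℂ) * circleMap 0 1 θ ∈ Metric.ball (0 : ℂ) 1 := by
  simp [abs_of_pos hr.1, hr.2]

lemma ofReal_mul_mem_ball {r : ℝ} (hr : r ∈ Ioo (0 : ℝ) 1) {z : ℂ}
    (hz : ‖z‖ ≤ 1) : (r : ℂ) * z ∈ Metric.ball (0 : ℂ) 1 := by
  rw [mem_ball_zero_iff, norm_mul, Complex.norm_real, norm_of_nonneg hr.1.le]
  nlinarith [hr.1, hr.2, norm_nonneg z]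

lemma eventually_mem_Ioo : ∀ᶠ r : ℝ in 𝓝[<] 1, r ∈ Ioo (0 : ℝ) 1 := Ioo_mem_nhdsLT (zero_lt_one' ℝ)

lemma tendsto_dilation {H : ℂ → ℂ} (hH : AnalyticOnNhd ℂ H (Metric.ball 0 1)) {z : ℂ}
    (hz : z ∈ Metric.ball (0 : ℂ) 1) :
    Tendsto (fun r : ℝ => H ((r : ℂ) * z)) (𝓝[<] 1) (𝓝 (H z)) := by
  have h1 : ContinuousAt H (((1 : ℝ) : ℂ) * z) := by simpa using (hH z hz).continuousAt
  have h2 : ContinuousAt (fun r : ℝ => H ((r : ℂ) * z)) 1 :=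
    h1.comp (f := fun r : ℝ => (r : ℂ) * z) (by fun_prop)
  simpa using h2.tendsto.mono_left nhdsWithin_le_nhds

lemma diffContOnCl_dilation {H : ℂ → ℂ} (hH : AnalyticOnNhd ℂ H (Metric.ball 0 1)) {r : ℝ}
    (hr : r ∈ Ioo (0 : ℝ) 1) : DiffContOnCl ℂ (fun w => H ((r : ℂ) * w)) (Metric.ball 0 1) := by
  refine DifferentiableOn.diffContOnCl fun w hw => ?_
  rw [closure_ball _ one_ne_zero, mem_closedBall_zero_iff] at hw
  have h1 : DifferentiableAt ℂ H ((r : ℂ) * w) :=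
    (hH _ (ofReal_mul_mem_ball hr hw)).differentiableAt
  exact (h1.comp w (by fun_prop : DifferentiableAt ℂ (fun w => (r : ℂ) * w) w)).differentiableWithinAt

lemma poisson_formula_dilation {H : ℂ → ℂ} (hH : AnalyticOnNhd ℂ H (Metric.ball 0 1)) {r : ℝ}
    (hr : r ∈ Ioo (0 : ℝ) 1) {z : ℂ} (hz : z ∈ Metric.ball (0 : ℂ) 1) :
    circleAverage (fun ζ => (poissonKernel 0 z ζ : ℂ) * H ((r : ℂ) * ζ)) 0 1
      = H ((r : ℂ) * z) := by
  rw [← (diffContOnCl_dilation hH hr).circleAverage_poissonKernel_smul hz]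
  rfl

lemma continuous_dilation_circleMap {H : ℂ → ℂ} (hH : AnalyticOnNhd ℂ H (Metric.ball 0 1)) {r : ℝ}
    (hr : r ∈ Ioo (0 : ℝ) 1) : Continuous fun θ => H ((r : ℂ) * circleMap 0 1 θ) :=
  hH.continuousOn.comp_continuous (by fun_prop) (ofReal_mul_circleMap_mem_ball hr)

/-- The maximum with `1` prepares the limit `r → 1`: when boundary moduli are at most one, the
integrand tends to the Poisson kernel itself, so the boundary function never has to be integrated.
-/
lemma norm_dilation_le {H : ℂ → ℂ} (hH : AnalyticOnNhd ℂ H (Metric.ball 0 1)) {r : ℝ}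
    (hr : r ∈ Ioo (0 : ℝ) 1) {z : ℂ} (hz : z ∈ Metric.ball (0 : ℂ) 1) :
    ‖H ((r : ℂ) * z)‖ ≤
      circleAverage (fun ζ => poissonKernel 0 z ζ * max ‖H ((r : ℂ) * ζ)‖ 1) 0 1 := by
  have hc := continuous_dilation_circleMap hH hr
  have hp := continuous_poissonKernel_circleMap hz
  rw [← poisson_formula_dilation hH hr hz, circleAverage_def, circleAverage_def, norm_smul,
    norm_of_nonneg (by positivity), smul_eq_mul]
  gcongr
  refine (intervalIntegral.norm_integral_le_integral_norm (by positivity)).trans ?_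
  refine intervalIntegral.integral_mono_on (by positivity)
    (((Complex.continuous_ofReal.comp hp).mul hc).norm.intervalIntegrable _ _)
    ((hp.mul (hc.norm.max continuous_const)).intervalIntegrable _ _) fun θ _ => ?_
  have h0 := poissonKernel_nonneg hz (circleMap_mem_unit_sphere θ)
  rw [norm_mul, Complex.norm_real, norm_of_nonneg h0]
  gcongr
  exact le_max_left _ _

/-- A bounded analytic function whose radial boundary moduli are at most one almost everywhere is
bounded by one. -/
theorem norm_le_one_of_ae_radial {H : ℂ → ℂ} (hH : IsBoundedAnalytic H)
    (hb : ∀ᵐ θ : ℝ, ∃ s ≤ 1,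
      Tendsto (fun r : ℝ => ‖H ((r : ℂ) * circleMap 0 1 θ)‖) (𝓝[<] 1) (𝓝 s))
    {z : ℂ} (hz : z ∈ Metric.ball (0 : ℂ) 1) : ‖H z‖ ≤ 1 := by
  obtain ⟨han, C, hC⟩ := hH
  have hp := continuous_poissonKernel_circleMap hz
  have hlim : Tendsto (fun r : ℝ =>
      circleAverage (fun ζ => poissonKernel 0 z ζ * max ‖H ((r : ℂ) * ζ)‖ 1) 0 1) (𝓝[<] 1)
      (𝓝 (circleAverage (fun ζ => poissonKernel 0 z ζ * 1) 0 1)) := by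
    simp only [circleAverage_def]
    refine Tendsto.const_smul ?_ _
    refine intervalIntegral.tendsto_integral_filter_of_dominated_convergence
      (fun θ => poissonKernel 0 z (circleMap 0 1 θ) * max C 1) ?_ ?_
      (Continuous.intervalIntegrable (by fun_prop) _ _) ?_
    · filter_upwards [eventually_mem_Ioo] with r hr
      have hc := continuous_dilation_circleMap han hr
      exact (hp.mul (hc.norm.max continuous_const)).aestronglyMeasurable
    · filter_upwards [eventually_mem_Ioo] with r hr
      refine Eventually.of_forall fun θ _ => ?_
      have h0 := poissonKernel_nonneg hz (circleMap_mem_unit_sphere θ)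
      rw [norm_mul, norm_of_nonneg h0, norm_of_nonneg (by positivity)]
      gcongr
      exact hC _ (ofReal_mul_circleMap_mem_ball hr θ)
    · filter_upwards [hb] with θ ⟨s, hs, h⟩ _
      have h1 := h.max (tendsto_const_nhds (x := (1 : ℝ)))
      rw [max_eq_right hs] at h1
      exact h1.const_mul _
  rw [show circleAverage (fun ζ => poissonKernel 0 z ζ * 1) 0 1 = 1 from
    poissonIntegral_const hz 1] at hlim
  exact le_of_tendsto_of_tendsto (tendsto_dilation han hz).norm hlim
    (by filter_upwards [eventually_mem_Ioo] with r hr using norm_dilation_le han hr hz)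

/-! ### Outer functions and domination by them. -/

/-- The outer function with boundary log-modulus `φ`. -/
noncomputable def outerOf (φ : ℂ → ℝ) (z : ℂ) : ℂ :=
  Complex.exp (circleAverage (fun ζ : ℂ => (ζ + z) / (ζ - z) * (φ ζ : ℂ)) 0 1)

lemma CircleIntegrable.ofReal {φ : ℂ → ℝ} (hφ : CircleIntegrable φ 0 1) :
    CircleIntegrable (fun ζ => (φ ζ : ℂ)) 0 1 :=
  ⟨hφ.1.ofReal, hφ.2.ofReal⟩

lemma norm_outerOf {φ : ℂ → ℝ} (hφ : CircleIntegrable φ 0 1) {z : ℂ}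
    (hz : z ∈ Metric.ball (0 : ℂ) 1) : ‖outerOf φ z‖ = exp (poissonIntegral φ z) := by
  rw [outerOf, Complex.norm_exp]
  have := re_circleAverage_herglotzRieszKernel_smul hφ hz
  simp only [herglotzRieszKernel_def, sub_zero, smul_eq_mul] at this
  rw [this, poissonIntegral, poissonKernel_eq_re_herglotzRieszKernel]
  rfl

lemma analyticOnNhd_outerOf {φ : ℂ → ℝ} (hφ : CircleIntegrable φ 0 1) :
    AnalyticOnNhd ℂ (outerOf φ) (Metric.ball 0 1) := by
  have := analyticOnNhd_circleAverage_herglotzRieszKernel_smul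
    (f := fun ζ => (φ ζ : ℂ)) (CircleIntegrable.ofReal hφ)
  simp only [herglotzRieszKernel_def, sub_zero, smul_eq_mul] at this
  exact this.cexp

lemma outerOf_ne_zero (φ : ℂ → ℝ) (z : ℂ) : outerOf φ z ≠ 0 := Complex.exp_ne_zero _

lemma ae_tendsto_norm_outerOf {φ : ℂ → ℝ} (hφ : CircleIntegrable φ 0 1) :
    ∀ᵐ θ : ℝ, Tendsto (fun r : ℝ => ‖outerOf φ ((r : ℂ) * circleMap 0 1 θ)‖) (𝓝[<] 1)
      (𝓝 (exp (φ (circleMap 0 1 θ)))) := by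
  filter_upwards [ae_tendsto_poissonIntegral hφ] with θ h
  refine ((continuous_exp.tendsto _).comp h).congr' ?_
  filter_upwards [eventually_mem_Ioo] with r hr
  exact (norm_outerOf hφ (ofReal_mul_circleMap_mem_ball hr θ)).symm

lemma poissonIntegral_mono {φ ψ : ℂ → ℝ} (hφ : CircleIntegrable φ 0 1)
    (hψ : CircleIntegrable ψ 0 1) (h : ∀ ζ, φ ζ ≤ ψ ζ) {z : ℂ} (hz : z ∈ Metric.ball (0 : ℂ) 1) :
    poissonIntegral φ z ≤ poissonIntegral ψ z :=
  circleAverage_mono (CircleIntegrable.poissonKernel_mul hφ hz)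
    (CircleIntegrable.poissonKernel_mul hψ hz) fun ζ hζ =>
      mul_le_mul_of_nonneg_left (h ζ) (poissonKernel_nonneg hz (by simpa using hζ))

lemma CircleIntegrable.max_const {φ : ℂ → ℝ} (hφ : CircleIntegrable φ 0 1) (c : ℝ) :
    CircleIntegrable (fun ζ => max (φ ζ) c) 0 1 := by
  have hc : CircleIntegrable (fun _ : ℂ => c) 0 1 := circleIntegrable_const c 0 1
  exact ⟨hφ.1.sup hc.1, hφ.2.sup hc.2⟩

lemma tendsto_poissonIntegral_max {φ : ℂ → ℝ} (hφ : CircleIntegrable φ 0 1) {z : ℂ}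
    (hz : z ∈ Metric.ball (0 : ℂ) 1) :
    Tendsto (fun n : ℕ => poissonIntegral (fun ζ => max (φ ζ) (-(n : ℝ))) z) atTop
      (𝓝 (poissonIntegral φ z)) := by
  simp only [poissonIntegral, circleAverage_def]
  refine Tendsto.const_smul ?_ _
  refine intervalIntegral.tendsto_integral_filter_of_dominated_convergence
    (fun θ => ‖poissonKernel 0 z (circleMap 0 1 θ) * φ (circleMap 0 1 θ)‖) ?_ ?_
    (CircleIntegrable.poissonKernel_mul hφ hz).norm ?_
  · refine Eventually.of_forall fun n => ?_
    exact (intervalIntegrable_iff.1 (CircleIntegrable.poissonKernel_mul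
      (CircleIntegrable.max_const hφ (-(n : ℝ))) hz)).aestronglyMeasurable
  · refine Eventually.of_forall fun n => Eventually.of_forall fun θ _ => ?_
    rw [norm_mul, norm_mul]
    gcongr
    rw [norm_eq_abs, norm_eq_abs, abs_le]
    have hn : (0 : ℝ) ≤ n := n.cast_nonneg
    exact ⟨(neg_abs_le _).trans (le_max_left _ _),
      max_le (le_abs_self _) (by linarith [abs_nonneg (φ (circleMap 0 1 θ))])⟩
  · refine Eventually.of_forall fun θ _ => Tendsto.const_mul _ ?_
    refine tendsto_const_nhds.congr' ?_
    filter_upwards [tendsto_natCast_atTop_atTop.eventually_ge_atTop (-φ (circleMap 0 1 θ))]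
      with n hn
    rw [max_eq_left (by linarith)]

/-- The log-modulus of a bounded analytic function is dominated by the Poisson integral of its
boundary log-modulus. -/
theorem norm_le_exp_poissonIntegral {G : ℂ → ℂ} (hG : IsBoundedAnalytic G) {Φ : ℂ → ℝ}
    (hΦ : CircleIntegrable Φ 0 1)
    (hb : ∀ᵐ θ : ℝ, Tendsto (fun r : ℝ => ‖G ((r : ℂ) * circleMap 0 1 θ)‖) (𝓝[<] 1)
      (𝓝 (exp (Φ (circleMap 0 1 θ)))))
    {z : ℂ} (hz : z ∈ Metric.ball (0 : ℂ) 1) : ‖G z‖ ≤ ‖outerOf Φ z‖ := by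
  rw [norm_outerOf hΦ hz]
  -- Truncating `Φ` below at `-n` keeps the outer denominator at least `exp (-n)` in modulus, so the
  -- quotient is bounded and the maximum principle applies; then `n → ∞`.
  refine ge_of_tendsto' ((continuous_exp.tendsto _).comp (tendsto_poissonIntegral_max hΦ hz))
    fun n => ?_
  have hΦn := CircleIntegrable.max_const hΦ (-(n : ℝ))
  set Ψ : ℂ → ℝ := fun ζ => max (Φ ζ) (-(n : ℝ))
  have hlow : ∀ w ∈ Metric.ball (0 : ℂ) 1, exp (-(n : ℝ)) ≤ ‖outerOf Ψ w‖ := fun w hw => by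
    rw [norm_outerOf hΦn hw, exp_le_exp]
    have := poissonIntegral_mono (circleIntegrable_const (-(n : ℝ)) 0 1) hΦn
      (fun ζ => le_max_right _ _) hw
    rwa [poissonIntegral_const hw] at this
  obtain ⟨han, C, hC⟩ := hG
  have hH : IsBoundedAnalytic fun w => G w / outerOf Ψ w := by
    refine ⟨han.div (analyticOnNhd_outerOf hΦn) fun w _ => outerOf_ne_zero _ _,
      C / exp (-(n : ℝ)), fun w hw => ?_⟩
    rw [norm_div]
    exact div_le_div₀ ((norm_nonneg _).trans (hC w hw)) (hC w hw) (exp_pos _) (hlow w hw)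
  have h1 := norm_le_one_of_ae_radial hH ?_ hz
  · rw [norm_div, norm_outerOf hΦn hz, div_le_one (exp_pos _)] at h1
    exact h1
  · filter_upwards [hb, ae_tendsto_norm_outerOf hΦn] with θ h h'
    refine ⟨_, ?_, (h.div h' (exp_pos _).ne').congr fun r => (norm_div _ _).symm⟩
    rw [div_le_one (exp_pos _), exp_le_exp]
    exact le_max_left _ _

/-! ### Weak compactness and radial limits of bounded analytic functions. -/

/-- Banach–Alaoglu gives a weak-* cluster point; any pairing that converges must converge to its
value there, so no subsequence is extracted. -/
lemma exists_weak_limit {E ι : Type*} [NormedAddCommGroup E] [InnerProductSpace ℂ E]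
    [CompleteSpace E] {l : Filter ι} [NeBot l] {x : ι → E} {M : ℝ} (hx : ∀ᶠ i in l, ‖x i‖ ≤ M) :
    ∃ v : E, ∀ (k : E) (a : ℂ), Tendsto (fun i => inner ℂ (x i) k) l (𝓝 a) → inner ℂ v k = a := by
  let y : ι → WeakDual ℂ E := fun i =>
    StrongDual.toWeakDual (InnerProductSpace.toDual ℂ E (x i))
  obtain ⟨ℓ, -, hℓ⟩ := (WeakDual.isCompact_closedBall (𝕜 := ℂ) (E := E) 0 M).exists_mapClusterPt
    (f := l) (u := y) (by
      refine tendsto_principal.2 ?_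
      filter_upwards [hx] with i hi
      simpa [y] using hi)
  refine ⟨(InnerProductSpace.toDual ℂ E).symm (WeakDual.toStrongDual ℓ), fun k a ha => ?_⟩
  rw [InnerProductSpace.toDual_symm_apply]
  have h1 : MapClusterPt (ℓ k) l (fun i => y i k) :=
    hℓ.continuousAt_comp (f := fun ℓ : WeakDual ℂ E => ℓ k) (WeakDual.eval_continuous k).continuousAt
  have h2 : Tendsto (fun i => y i k) l (𝓝 a) := ha
  have h3 : ClusterPt (ℓ k) (𝓝 a) := ClusterPt.mono h1 h2
  exact eq_of_nhds_neBot h3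

/-- Arc length on the unit circle, as a measure on the plane. -/
noncomputable def circleMeasure : Measure ℂ :=
  (volume.restrict (Ioc 0 (2 * π))).map (circleMap 0 1)

instance : IsFiniteMeasure circleMeasure :=
  Measure.isFiniteMeasure_map _ _

lemma ae_circleMeasure_mem_sphere : ∀ᵐ ζ ∂circleMeasure, ζ ∈ Metric.sphere (0 : ℂ) 1 := by
  exact (ae_map_iff (measurable_circleMap 0 1).aemeasurable
    Metric.isClosed_sphere.measurableSet).2 (Eventually.of_forall circleMap_mem_unit_sphere)

lemma memLp_circleMeasure_of_continuousOn {F : ℂ → ℂ} (hF : ContinuousOn F (Metric.sphere 0 1)) :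
    MemLp F 2 circleMeasure := by
  have hs : circleMeasure.restrict (Metric.sphere 0 1) = circleMeasure :=
    Measure.restrict_eq_self_of_ae_mem ae_circleMeasure_mem_sphere
  have hm : AEStronglyMeasurable F circleMeasure := by
    rw [← hs]; exact hF.aestronglyMeasurable Metric.isClosed_sphere.measurableSet
  obtain ⟨C, hC⟩ := (isCompact_sphere (0 : ℂ) 1).exists_bound_of_continuousOn hF
  exact MemLp.of_bound hm C (ae_circleMeasure_mem_sphere.mono hC)

lemma integral_circleMeasure {F : ℂ → ℂ} (hF : AEStronglyMeasurable F circleMeasure) :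
    ∫ ζ, F ζ ∂circleMeasure = ∫ θ in (0 : ℝ)..2 * π, F (circleMap 0 1 θ) := by
  rw [intervalIntegral.integral_of_le (by positivity), circleMeasure,
    integral_map (measurable_circleMap 0 1).aemeasurable hF]

lemma circleIntegrable_of_integrable {F : ℂ → ℂ} (hF : Integrable F circleMeasure) :
    CircleIntegrable F 0 1 := by
  rw [CircleIntegrable, intervalIntegrable_iff, uIoc_of_le (by positivity)]
  exact hF.comp_measurable (measurable_circleMap 0 1)

/-- A bounded analytic function on the disc is the Poisson integral of an integrable function on
the circle. -/
theorem exists_poisson_representation {H : ℂ → ℂ} (hH : IsBoundedAnalytic H) :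
    ∃ v : ℂ → ℂ, CircleIntegrable v 0 1 ∧ ∀ z ∈ Metric.ball (0 : ℂ) 1,
      H z = circleAverage (fun ζ => (poissonKernel 0 z ζ : ℂ) * v ζ) 0 1 := by
  classical
  obtain ⟨han, C, hC⟩ := hH
  have hC0 : 0 ≤ C := (norm_nonneg _).trans (hC 0 (by simp))
  -- The conjugate is stored because `inner` is conjugate-linear in its first argument: pairing with
  -- the Poisson kernel then returns `H` itself.
  have hmem : ∀ r ∈ Ioo (0 : ℝ) 1,
      MemLp (fun ζ => starRingEnd ℂ (H ((r : ℂ) * ζ))) 2 circleMeasure := fun r hr => by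
    refine memLp_circleMeasure_of_continuousOn (Complex.continuous_conj.comp_continuousOn ?_)
    exact han.continuousOn.comp (by fun_prop) fun ζ hζ => ofReal_mul_mem_ball hr
      (by simpa using hζ.le)
  let x : ℝ → Lp ℂ 2 circleMeasure := fun r =>
    if hr : r ∈ Ioo (0 : ℝ) 1 then (hmem r hr).toLp else 0
  have hxe : ∀ r (hr : r ∈ Ioo (0 : ℝ) 1), x r =ᵐ[circleMeasure]
      fun ζ => starRingEnd ℂ (H ((r : ℂ) * ζ)) := fun r hr => by
    simp only [x, dif_pos hr]
    exact (hmem r hr).coeFn_toLp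
  have hxb : ∀ᶠ r in 𝓝[<] (1 : ℝ),
      ‖x r‖ ≤ measureUnivNNReal circleMeasure ^ (2 : ENNReal).toReal⁻¹ * C := by
    filter_upwards [eventually_mem_Ioo] with r hr
    refine Lp.norm_le_of_ae_bound hC0 ?_
    filter_upwards [hxe r hr, ae_circleMeasure_mem_sphere] with ζ h1 h2
    rw [h1, RCLike.norm_conj]
    exact hC _ (ofReal_mul_mem_ball hr (by simpa using h2.le))
  obtain ⟨V, hV⟩ := exists_weak_limit hxb
  have hVi : Integrable V circleMeasure := (Lp.memLp V).integrable one_le_two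
  refine ⟨fun ζ => starRingEnd ℂ (V ζ), ?_, fun z hz => ?_⟩
  · refine circleIntegrable_of_integrable ?_
    exact (LinearIsometryEquiv.integrable_comp_iff Complex.conjLIE).2 hVi
  have hk : MemLp (fun ζ => (poissonKernel 0 z ζ : ℂ)) 2 circleMeasure :=
    memLp_circleMeasure_of_continuousOn
      (Complex.continuous_ofReal.comp_continuousOn (continuousOn_poissonKernel_sphere hz))
  have hinner : ∀ W : Lp ℂ 2 circleMeasure, inner ℂ W hk.toLp
      = ∫ ζ, (poissonKernel 0 z ζ : ℂ) * starRingEnd ℂ (W ζ) ∂circleMeasure := fun W => by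
    rw [L2.inner_def]
    refine integral_congr_ae ?_
    filter_upwards [hk.coeFn_toLp] with ζ h
    rw [h, RCLike.inner_apply]
  -- The factor `2π` is the total mass of `circleMeasure`.
  have h1 := hV hk.toLp (2 * π * H z) ?_
  · rw [hinner, integral_circleMeasure] at h1
    · rw [circleAverage_def, h1, Complex.real_smul]
      push_cast
      field_simp
    · exact hk.1.mul (Complex.continuous_conj.comp_aestronglyMeasurable hVi.1)
  · refine ((tendsto_dilation han hz).const_mul (2 * π : ℂ)).congr' ?_
    filter_upwards [eventually_mem_Ioo] with r hr
    have h2 : ∫ ζ, (poissonKernel 0 z ζ : ℂ) * starRingEnd ℂ (x r ζ) ∂circleMeasure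
        = ∫ ζ, (poissonKernel 0 z ζ : ℂ) * H ((r : ℂ) * ζ) ∂circleMeasure := by
      refine integral_congr_ae ?_
      filter_upwards [hxe r hr] with ζ h
      rw [h, Complex.conj_conj]
    have h3 : AEStronglyMeasurable (fun ζ => H ((r : ℂ) * ζ)) circleMeasure := by
      simpa using Complex.continuous_conj.comp_aestronglyMeasurable (hmem r hr).1
    rw [hinner, h2, integral_circleMeasure (F := fun ζ => (poissonKernel 0 z ζ : ℂ) * H (r * ζ))
      (hk.1.mul h3), ← poisson_formula_dilation han hr hz,
      circleAverage_def, Complex.real_smul]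
    push_cast
    field_simp

/-- **Fatou's theorem** for bounded analytic functions. -/
theorem IsBoundedAnalytic.ae_hasRadialLimit {H : ℂ → ℂ} (hH : IsBoundedAnalytic H) :
    ∀ᵐ θ : ℝ, ∃ w, HasRadialLimit H (circleMap 0 1 θ) w := by
  obtain ⟨v, hv, hrep⟩ := exists_poisson_representation hH
  have hre : CircleIntegrable (fun ζ => (v ζ).re) 0 1 := ⟨hv.1.re, hv.2.re⟩
  have him : CircleIntegrable (fun ζ => (v ζ).im) 0 1 := ⟨hv.1.im, hv.2.im⟩
  have hdecomp : ∀ z ∈ Metric.ball (0 : ℂ) 1, H z = (poissonIntegral (fun ζ => (v ζ).re) z : ℂ)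
      + (poissonIntegral (fun ζ => (v ζ).im) z : ℂ) * Complex.I := fun z hz => by
    have hi : CircleIntegrable (fun ζ => (poissonKernel 0 z ζ : ℂ) * v ζ) 0 1 :=
      IntervalIntegrable.continuousOn_mul hv
        (Complex.continuous_ofReal.comp (continuous_poissonKernel_circleMap hz)).continuousOn
    have h1 := Complex.reCLM.circleAverage_comp_comm hi
    have h2 := Complex.imCLM.circleAverage_comp_comm hi
    rw [← hrep z hz] at h1 h2
    rw [← Complex.re_add_im (H z)]
    simp only [Complex.reCLM_apply, Complex.imCLM_apply] at h1 h2
    rw [← h1, ← h2]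
    simp [poissonIntegral, Function.comp_def]
  filter_upwards [ae_tendsto_poissonIntegral hre, ae_tendsto_poissonIntegral him] with θ h1 h2
  refine ⟨_, Tendsto.congr' ?_ (((Complex.continuous_ofReal.tendsto _).comp h1).add
    (((Complex.continuous_ofReal.tendsto _).comp h2).mul_const Complex.I))⟩
  filter_upwards [eventually_mem_Ioo] with r hr
  exact (hdecomp _ (ofReal_mul_circleMap_mem_ball hr θ)).symm

/-! ### Inner quotients and the algebra of outer functions. -/

/-- Dividing a bounded analytic function by the outer function with the same boundary modulus
gives an inner function. -/
theorem isInner_div_outerOf {G : ℂ → ℂ} (hG : IsBoundedAnalytic G) {Φ : ℂ → ℝ}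
    (hΦ : CircleIntegrable Φ 0 1)
    (hb : ∀ᵐ θ : ℝ, Tendsto (fun r : ℝ => ‖G ((r : ℂ) * circleMap 0 1 θ)‖) (𝓝[<] 1)
      (𝓝 (exp (Φ (circleMap 0 1 θ))))) :
    IsInner fun z => G z / outerOf Φ z := by
  have hbd : IsBoundedAnalytic fun z => G z / outerOf Φ z := by
    refine ⟨hG.1.div (analyticOnNhd_outerOf hΦ) fun z _ => outerOf_ne_zero _ _, 1, fun z hz => ?_⟩
    rw [norm_div]
    exact div_le_one_of_le₀ (norm_le_exp_poissonIntegral hG hΦ hb hz) (norm_nonneg _)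
  refine ⟨hbd, ?_⟩
  filter_upwards [hbd.ae_hasRadialLimit, hb, ae_tendsto_norm_outerOf hΦ] with θ ⟨w, hw⟩ h1 h2
  refine ⟨w, tendsto_nhds_unique (Tendsto.norm hw) ?_, hw⟩
  have := h1.div h2 (exp_pos _).ne'
  rw [div_self (exp_pos _).ne'] at this
  exact this.congr fun r => (norm_div _ _).symm

lemma outerOf_div_outerOf {φ ψ : ℂ → ℝ} (hφ : CircleIntegrable φ 0 1)
    (hψ : CircleIntegrable ψ 0 1) {z : ℂ} (hz : z ∈ Metric.ball (0 : ℂ) 1) :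
    outerOf φ z / outerOf ψ z = outerOf (fun ζ => φ ζ - ψ ζ) z := by
  have hk : ∀ {χ : ℂ → ℝ}, CircleIntegrable χ 0 1 →
      CircleIntegrable (fun ζ : ℂ => (ζ + z) / (ζ - z) * (χ ζ : ℂ)) 0 1 := fun hχ => by
    have := (CircleIntegrable.ofReal hχ).continuousOn_smul
      (continuousOn_herglotzRieszKernel_sphere hz)
    simp only [herglotzRieszKernel_fun_def, sub_zero] at this
    exact this
  rw [outerOf, outerOf, outerOf, ← Complex.exp_sub, ← circleAverage_fun_sub (hk hφ) (hk hψ)]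
  simp only [Complex.ofReal_sub, mul_sub]

/-- Since `(ζ + z) / (ζ - z) = 2ζ / (ζ - z) - 1`, Cauchy's formula evaluates the average as `2c -
c`. -/
lemma outerOf_const {z : ℂ} (hz : z ∈ Metric.ball (0 : ℂ) 1) (c : ℝ) :
    outerOf (fun _ => c) z = Complex.exp c := by
  have h1 := DiffContOnCl.circleAverage_smul_div (f := fun _ => (2 * c : ℂ)) (c := 0) (R := 1)
    (w := z) diffContOnCl_const (by simpa using hz)
  have hne : ∀ ζ ∈ Metric.sphere (0 : ℂ) 1, ζ - z ≠ 0 := fun ζ hζ h0 => by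
    rw [sub_eq_zero.1 h0, mem_sphere_zero_iff_norm] at hζ
    rw [mem_ball_zero_iff] at hz
    exact hz.ne hζ
  have h2 : CircleIntegrable (fun ζ : ℂ => ((ζ - 0) / (ζ - z)) • (2 * c : ℂ)) 0 1 :=
    ContinuousOn.circleIntegrable zero_le_one
      (((by fun_prop : ContinuousOn (fun ζ : ℂ => ζ - 0) _).div (by fun_prop) hne).smul
        continuousOn_const)
  have h3 := circleAverage_fun_sub h2 (circleIntegrable_const (c : ℂ) 0 1)
  rw [h1, circleAverage_const] at h3
  rw [show 2 * (c : ℂ) - c = c by ring] at h3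
  unfold outerOf
  congr 1
  refine Eq.trans ?_ h3
  refine circleAverage_congr_sphere fun ζ hζ => ?_
  have := hne ζ (by simpa using hζ)
  simp only [smul_eq_mul]
  field_simp
  ring

/-! ### Helson's theorem. -/

/-- The boundary function of a real Smirnov function is almost everywhere measurable. -/
lemma exists_real_boundary_function {f : ℂ → ℂ}
    (hf : ContinuousOn f (Metric.ball 0 1))
    (hb : ∀ᵐ θ : ℝ, ∃ x : ℝ, HasRadialLimit f (circleMap 0 1 θ) (x : ℂ)) :
    ∃ x : ℂ → ℝ, AEMeasurable (fun θ => x (circleMap 0 1 θ)) ∧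
      ∀ᵐ θ : ℝ, HasRadialLimit f (circleMap 0 1 θ) (x (circleMap 0 1 θ)) := by
  classical
  let x : ℂ → ℝ := fun ζ => if h : ∃ x : ℝ, HasRadialLimit f ζ (x : ℂ) then h.choose else 0
  have hx : ∀ᵐ θ : ℝ, HasRadialLimit f (circleMap 0 1 θ) (x (circleMap 0 1 θ)) := by
    filter_upwards [hb] with θ h
    simp only [x, dif_pos h]
    exact h.choose_spec
  refine ⟨x, ?_, hx⟩
  -- Along a sequence of radii, `x` is an almost everywhere limit of continuous functions of `θ`, so
  -- its pointwise choice does no harm.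
  obtain ⟨r, -, hr, hr1⟩ := exists_seq_strictMono_tendsto' (zero_lt_one' ℝ)
  have hr1' : Tendsto r atTop (𝓝[<] 1) :=
    tendsto_nhdsWithin_iff.2 ⟨hr1, Eventually.of_forall fun n => (hr n).2⟩
  refine aemeasurable_of_tendsto_metrizable_ae atTop
    (f := fun n θ => (f ((r n : ℂ) * circleMap 0 1 θ)).re) (fun n => ?_) ?_
  · have : Continuous fun θ => f ((r n : ℂ) * circleMap 0 1 θ) :=
      hf.comp_continuous (by fun_prop) (ofReal_mul_circleMap_mem_ball (hr n))
    exact (Complex.continuous_re.comp this).measurable.aemeasurable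
  · filter_upwards [hx] with θ h
    have := (Complex.continuous_re.tendsto _).comp (h.comp hr1')
    rw [Complex.ofReal_re] at this
    exact this

/-- **Helson's theorem**: real Smirnov functions are Cayley-type quotients of inner functions. -/
theorem IsRealSmirnov.exists_isInner_isOuter {f : ℂ → ℂ} (hf : IsRealSmirnov f) :
    ∃ ψ₁ ψ₂ : ℂ → ℂ, IsInner ψ₁ ∧ IsInner ψ₂ ∧ IsOuter (fun z => ψ₁ z - ψ₂ z) ∧
      ∀ z ∈ Metric.ball (0 : ℂ) 1, f z = Complex.I * ((ψ₁ z + ψ₂ z) / (ψ₁ z - ψ₂ z)) := by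
  obtain ⟨⟨g, h, hg, hh, ⟨γ, φ, hφ, hhφ⟩, hfgh⟩, hb⟩ := hf
  replace hhφ : ∀ z ∈ Metric.ball (0 : ℂ) 1, h z = Complex.exp (γ * Complex.I) * outerOf φ z := hhφ
  have hh0 : ∀ z ∈ Metric.ball (0 : ℂ) 1, h z ≠ 0 := fun z hz => by
    rw [hhφ z hz]
    exact mul_ne_zero (Complex.exp_ne_zero _) (outerOf_ne_zero _ _)
  have hfc : ContinuousOn f (Metric.ball 0 1) :=
    (hg.1.continuousOn.div hh.1.continuousOn hh0).congr hfgh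
  obtain ⟨x, hxm, hx⟩ := exists_real_boundary_function hfc hb
  let Φ : ℂ → ℝ := fun ζ => φ ζ + 1 / 2 * log (1 + x ζ ^ 2)
  have hG : ∀ c : ℂ, ‖c‖ = 1 → IsBoundedAnalytic fun z => g z + c * h z := by
    intro c hc
    obtain ⟨hga, A, hA⟩ := hg
    obtain ⟨hha, B, hB⟩ := hh
    refine ⟨hga.add (analyticOnNhd_const.mul hha), A + B, fun z hz => ?_⟩
    refine (norm_add_le _ _).trans (add_le_add (hA z hz) ?_)
    rw [norm_mul, hc, one_mul]
    exact hB z hz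
  have hexpΦ : ∀ ζ, exp (Φ ζ) = exp (φ ζ) * √(1 + x ζ ^ 2) := fun ζ => by
    rw [exp_add, sqrt_eq_rpow, rpow_def_of_pos (by positivity), mul_comm (1 / 2)]
  have hGb : ∀ σ : ℝ, σ ^ 2 = 1 → ∀ᵐ θ : ℝ,
      Tendsto (fun r : ℝ => ‖g ((r : ℂ) * circleMap 0 1 θ)
        + (σ * Complex.I) * h ((r : ℂ) * circleMap 0 1 θ)‖) (𝓝[<] 1)
        (𝓝 (exp (Φ (circleMap 0 1 θ)))) := by
    intro σ hσ
    filter_upwards [hx, ae_tendsto_norm_outerOf hφ] with θ h1 h2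
    -- Inside the disc `|g + σih| = |h| |f + σi|`, and `|h|` is the modulus of `outerOf φ`.
    have h3 := h2.mul (h1.add_const (σ * Complex.I)).norm
    have h4 : ‖(x (circleMap 0 1 θ) : ℂ) + σ * Complex.I‖
        = √(1 + x (circleMap 0 1 θ) ^ 2) := by
      rw [Complex.norm_add_mul_I, hσ, add_comm]
    rw [h4, ← hexpΦ] at h3
    refine h3.congr' ?_
    filter_upwards [eventually_mem_Ioo] with r hr
    have hz := ofReal_mul_circleMap_mem_ball hr θ
    set z := (r : ℂ) * circleMap 0 1 θ
    have h5 : ‖outerOf φ z‖ = ‖h z‖ := by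
      rw [hhφ z hz, norm_mul, Complex.norm_exp_ofReal_mul_I, one_mul]
    rw [h5, ← norm_mul, hfgh z hz]
    congr 1
    field_simp [hh0 z hz]
  have hΦ : CircleIntegrable Φ 0 1 := by
    obtain ⟨-, C, hC⟩ := hG (((1 : ℝ) : ℂ) * Complex.I) (by simp)
    have hΦle : ∀ᵐ θ : ℝ, Φ (circleMap 0 1 θ) ≤ |C| := by
      filter_upwards [hGb 1 (by norm_num)] with θ h1
      have h2 : exp (Φ (circleMap 0 1 θ)) ≤ C := by
        refine le_of_tendsto h1 ?_
        filter_upwards [eventually_mem_Ioo] with r hr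
        exact hC _ (ofReal_mul_circleMap_mem_ball hr θ)
      linarith [add_one_le_exp (Φ (circleMap 0 1 θ)), le_abs_self C]
    rw [CircleIntegrable, intervalIntegrable_iff, uIoc_of_le (by positivity)] at hφ ⊢
    -- The majorant combines `φ ≤ Φ` from below with `Φ ≤ |C|` from above.
    refine Integrable.mono' (hφ.norm.add (integrable_const |C|)) ?_ ?_
    · refine (hφ.aestronglyMeasurable.aemeasurable.add ?_).aestronglyMeasurable
      exact ((measurable_log.comp_aemeasurable
        ((hxm.restrict.pow_const 2).const_add 1)).const_mul (1 / 2))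
    · filter_upwards [ae_restrict_of_ae hΦle] with θ hθ
      have h1 : 0 ≤ log (1 + x (circleMap 0 1 θ) ^ 2) :=
        log_nonneg (by nlinarith [sq_nonneg (x (circleMap 0 1 θ))])
      have h2 := neg_abs_le (φ (circleMap 0 1 θ))
      have h3 := abs_nonneg (φ (circleMap 0 1 θ))
      have h4 := abs_nonneg C
      simp only [norm_eq_abs, Pi.add_apply]
      refine abs_le.2 ⟨?_, by linarith⟩
      simp only [Φ]
      linarith
  have hin : ∀ σ : ℝ, σ ^ 2 = 1 →
      IsInner fun z => (g z + (σ * Complex.I) * h z) / outerOf Φ z := fun σ hσ =>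
    isInner_div_outerOf (hG _ (by
      rw [norm_mul, Complex.norm_I, mul_one, Complex.norm_real, norm_eq_abs]
      exact (pow_eq_one_iff_of_nonneg (abs_nonneg σ) two_ne_zero).1 (by rw [sq_abs, hσ]))) hΦ (hGb σ hσ)
  have hsub : ∀ z, (g z + ((1 : ℝ) * Complex.I) * h z) / outerOf Φ z
      - (g z + ((-1 : ℝ) * Complex.I) * h z) / outerOf Φ z = 2 * Complex.I * h z / outerOf Φ z :=
    fun z => by push_cast; ring
  refine ⟨_, _, hin 1 (by norm_num), hin (-1) (by norm_num), ?_, fun z hz => ?_⟩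
  · have hlog : CircleIntegrable (fun _ : ℂ => -log 2) 0 1 := circleIntegrable_const _ 0 1
    -- The factor `2i` in `2ih / O` is absorbed here: `i` as the phase `π / 2`, and `2` as division
    -- by the constant outer function `exp (-log 2)`.
    refine ⟨γ + π / 2, fun ζ => φ ζ - Φ ζ - -log 2, (hφ.sub hΦ).sub hlog,
      fun z hz => ?_⟩
    have h1 : Complex.exp (((γ + π / 2 : ℝ) : ℂ) * Complex.I)
        = Complex.exp (γ * Complex.I) * Complex.I := by
      push_cast
      rw [add_mul, Complex.exp_add, Complex.exp_pi_div_two_mul_I]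
    refine (hsub z).trans ?_
    change _ = _ * outerOf (fun ζ => (φ - Φ) ζ - -log 2) z
    rw [h1, ← outerOf_div_outerOf (hφ.sub hΦ) hlog hz, outerOf_const hz]
    have h2 : outerOf (φ - Φ) z = outerOf φ z / outerOf Φ z := (outerOf_div_outerOf hφ hΦ hz).symm
    rw [h2, hhφ z hz, Complex.ofReal_neg, Complex.exp_neg, ← Complex.ofReal_exp,
      exp_log two_pos]
    push_cast
    field_simp
  · have hO := outerOf_ne_zero Φ z
    have hh0' := hh0 z hz
    rw [hsub, hfgh z hz]
    field_simp
    push_cast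
    ring_nf

end HardyDisc

theorem mainTheorem7 (f : ℂ → ℂ) (hf : HardyDisc.IsRealSmirnov f) :
    ∃ ψ₁ ψ₂ : ℂ → ℂ, HardyDisc.IsInner ψ₁ ∧ HardyDisc.IsInner ψ₂ ∧
      HardyDisc.IsOuter (fun z => ψ₁ z - ψ₂ z) ∧
      ∀ z ∈ Metric.ball (0 : ℂ) 1, f z = Complex.I * ((ψ₁ z + ψ₂ z) / (ψ₁ z - ψ₂ z)) := by
  exact hf.exists_isInner_isOuter
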